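/- For $q\in(1,2]$, a sequence $(d_i)_{i\ge 1}\in\{0,1\}^{\mathbb N}$ is called a $q$-expansion of $1$ if $1=\sum_{i=1}^\infty d_i q^{-i}$. Let $\mathcal U\subset(1,2]$ be the set of univoque bases of $1$, that is, of those $q\in(1,2]$ for which $1$ has exactly one $q$-expansion, and let $\overline{\mathcal U}$ be its topological closure in $\mathbb R$. Write $A+B=\{a+b: a\in A,\ b\in B\}$ and $A\cdot B=\{ab: a\in A,\ b\in B\}$ for $A,B\subseteq\mathbb R$. Then neither $\mathcal U+\mathcal U$ nor $\mathcal U\cdot\mathcal U$ is an interval, and neither $\overline{\mathcal U}+\overline{\mathcal U}$ nor $\overline{\mathcal U}\cdot\overline{\mathcal U}$ is an interval. -/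

import Mathlib

open scoped Pointwise

/-- A sequence `d = (d₁, d₂, …)` of zeros and ones (with `dᵢ` stored as `d (i - 1)`) is a
`q`-expansion of `x` if `x = ∑_{i ≥ 1} dᵢ / q ^ i`. -/
def IsExpansion (q x : ℝ) (d : ℕ → Fin 2) : Prop :=
  HasSum (fun i : ℕ => ((d i : ℕ) : ℝ) / q ^ (i + 1)) x

/-- The set of univoque bases of `x`: the bases `q ∈ (1, 2]` for which `x` has a unique
`q`-expansion. -/
def univoqueBases (x : ℝ) : Set ℝ :=
  {q : ℝ | q ∈ Set.Ioc 1 2 ∧ ∃! d : ℕ → Fin 2, IsExpansion q x d}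

/-!
The set `𝒰` of univoque bases has a hole that is wider than its distance to the bottom of `𝒰`:
with `m = 1.784`, `a = 1.7886`, `b = 1.796` one has `𝒰 ⊆ [m, a] ∪ [b, ∞)`, while `2a < m + b` and
`a² < mb`. A sum of two elements of such a set is at most `2a` (both summands `≤ a`) or at least
`m + b` (one summand `≥ b`), so sums avoid `(2a, m + b)`, and likewise products avoid `(a², mb)`.
As `[m, a] ∪ [b, ∞)` is closed, the same holds for the closure. Since `𝒰` has an element below `a`
and the element `2`, there are sums and products on both sides of these holes
(`not_ordConnected_add`, `not_ordConnected_mul`).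

Expansions of `x` in base `q` are read off from the orbits of `x` under the two maps `x ↦ q x`
(digit `0`) and `x ↦ q x - 1` (digit `1`) that remain in `[0, 1 / (q - 1)]`. There is a free choice
exactly when `1 ≤ q x ≤ 1 / (q - 1)`. If some orbit of `1` reaches this switch region, then `1` has
two expansions (`HasTwoExpansions.of_switch`); following the digits `11010` of the orbit and
inspecting when its points are in the switch region excludes all bases outside
`[m, a] ∪ [b, ∞)`. If the orbit of `1` avoids the switch region, then all digits are forced
(`existsUnique_isExpansion_of_forced`); this applies to the base `2` and to the base
`p ∈ (1.787, 1.788)` in which `1` has the expansion `1101 (0011)^∞`.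
-/

open Set Filter Topology

/-! ### Expansions and orbits -/

/-- A bounded orbit of `x ↦ q x - d n` determines an expansion of its starting point: the remainder
after `n` digits is `T n / q ^ n`. -/
lemma isExpansion_of_orbit {q C : ℝ} (hq : 1 < q) {T : ℕ → ℝ} {d : ℕ → Fin 2}
    (hT : ∀ n, T (n + 1) = q * T n - ((d n : ℕ) : ℝ)) (hb : ∀ n, |T n| ≤ C) :
    IsExpansion q (T 0) d := by
  have hq0 : (0 : ℝ) < q := by linarith
  have hsum : ∀ n, ∑ i ∈ Finset.range n, ((d i : ℕ) : ℝ) / q ^ (i + 1) = T 0 - T n / q ^ n := by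
    intro n
    induction n with
    | zero => simp
    | succ n ih =>
      rw [Finset.sum_range_succ, ih, hT]
      field_simp
      ring
  unfold IsExpansion
  rw [hasSum_iff_tendsto_nat_of_nonneg (fun i => by positivity)]
  simp_rw [hsum]
  have h0 : Tendsto (fun n => C * (q⁻¹) ^ n) atTop (𝓝 0) := by
    simpa using (tendsto_pow_atTop_nhds_zero_of_lt_one (inv_nonneg.2 hq0.le)
      (inv_lt_one_of_one_lt₀ hq)).const_mul C
  have h1 : Tendsto (fun n => T n / q ^ n) atTop (𝓝 0) := by
    refine squeeze_zero_norm (fun n => ?_) h0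
    rw [Real.norm_eq_abs, abs_div, abs_of_pos (pow_pos hq0 n), inv_pow, div_eq_mul_inv]
    exact mul_le_mul_of_nonneg_right (hb n) (by positivity)
  simpa using h1.const_sub (T 0)

/-- Deleting the first digit `d 0` moves the value `x` to `q x - d 0`. -/
lemma IsExpansion.tail {q x : ℝ} {d : ℕ → Fin 2} (hq : 1 < q) (h : IsExpansion q x d) :
    IsExpansion q (q * x - ((d 0 : ℕ) : ℝ)) (fun n => d (n + 1)) := by
  have hq0 : q ≠ 0 := by linarith
  have h1 := (hasSum_nat_add_iff' 1).2 (HasSum.mul_left q h)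
  unfold IsExpansion
  convert h1 using 1
  · rfl
  · funext i
    field_simp
    ring
  · rw [Finset.sum_range_one]
    field_simp
    ring

lemma IsExpansion.cons {q x : ℝ} {d : ℕ → Fin 2} (hq : 1 < q) (c : Fin 2)
    (h : IsExpansion q (q * x - ((c : ℕ) : ℝ)) d) :
    IsExpansion q x (fun n => Nat.casesOn n c d) := by
  have hq0 : q ≠ 0 := by linarith
  unfold IsExpansion
  rw [← hasSum_nat_add_iff' 1]
  convert HasSum.mul_left q⁻¹ h using 1
  · rfl
  · funext i
    field_simp
    ring
  · rw [Finset.sum_range_one]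
    change x - ((c : ℕ) : ℝ) / q ^ (0 + 1) = _
    field_simp
    ring

lemma IsExpansion.nonneg {q x : ℝ} {d : ℕ → Fin 2} (hq : 1 < q) (h : IsExpansion q x d) :
    0 ≤ x :=
  HasSum.nonneg (fun i => by positivity) h

lemma IsExpansion.le {q x : ℝ} {d : ℕ → Fin 2} (hq : 1 < q) (h : IsExpansion q x d) :
    x ≤ 1 / (q - 1) := by
  have hq0 : (0 : ℝ) < q := by linarith
  have hq1 : 0 < q - 1 := by linarith
  -- The largest value is taken by the digit sequence `111…`, whose orbit is constant.
  have h1 : IsExpansion q (1 / (q - 1)) (fun _ => 1) := by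
    refine isExpansion_of_orbit (T := fun _ => 1 / (q - 1)) (C := |1 / (q - 1)|) hq
      (fun n => ?_) (fun n => le_rfl)
    simp
    field_simp
    ring
  refine hasSum_le (fun i => ?_) h h1
  have : ((d i : ℕ) : ℝ) ≤ 1 := by exact_mod_cast Nat.le_of_lt_succ (d i).isLt
  simpa using div_le_div_of_nonneg_right this (by positivity : 0 ≤ q ^ (i + 1))

/-- The greedy algorithm: take the digit `1` whenever possible. -/
lemma exists_isExpansion {q x : ℝ} (hq : q ∈ Ioc (1 : ℝ) 2) (hx : x ∈ Icc 0 (1 / (q - 1))) :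
    ∃ d, IsExpansion q x d := by
  have hq1 : 0 < q - 1 := by linarith [hq.1]
  let c : ℝ → Fin 2 := fun t => if 1 ≤ q * t then 1 else 0
  let f : ℝ → ℝ := fun t => q * t - ((c t : ℕ) : ℝ)
  have hf : ∀ t ∈ Icc 0 (1 / (q - 1)), f t ∈ Icc 0 (1 / (q - 1)) := by
    rintro t ⟨h0, h1⟩
    -- `q ≤ 2` enters here: it says that `1 ≤ 1 / (q - 1)`, so the digit `0` keeps below the bound.
    have h2 : 1 ≤ 1 / (q - 1) := by rw [le_div_iff₀ hq1]; linarith [hq.2]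
    have h3 : q * (1 / (q - 1)) = 1 / (q - 1) + 1 := by field_simp; ring
    have h4 := mul_le_mul_of_nonneg_left h1 (by linarith : 0 ≤ q)
    by_cases h : 1 ≤ q * t
    · simp only [f, c, h, if_true, mem_Icc]
      constructor <;> norm_num <;> simp only [one_div] at * <;> linarith
    · simp only [f, c, h, if_false, mem_Icc]
      have := mul_nonneg (by linarith : 0 ≤ q) h0
      constructor <;> norm_num <;> simp only [one_div] at * <;> linarith
  have hmem : ∀ n, f^[n] x ∈ Icc 0 (1 / (q - 1)) := by
    intro n
    induction n with
    | zero => exact hx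
    | succ n ih => rw [Function.iterate_succ_apply']; exact hf _ ih
  refine ⟨fun n => c (f^[n] x), isExpansion_of_orbit (T := fun n => f^[n] x) (C := 1 / (q - 1))
    hq.1 (fun n => ?_) (fun n => ?_)⟩
  · rw [Function.iterate_succ_apply']
  · rw [abs_of_nonneg (hmem n).1]; exact (hmem n).2

/-! ### Several expansions -/

/-- `x` has at least two different expansions in base `q`. -/
def HasTwoExpansions (q x : ℝ) : Prop :=
  ∃ d e : ℕ → Fin 2, d ≠ e ∧ IsExpansion q x d ∧ IsExpansion q x e

lemma HasTwoExpansions.not_existsUnique {q x : ℝ} (h : HasTwoExpansions q x) :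
    ¬ ∃! d : ℕ → Fin 2, IsExpansion q x d := by
  obtain ⟨d, e, hne, hd, he⟩ := h
  exact fun hu => hne (hu.unique hd he)

lemma HasTwoExpansions.cons {q x : ℝ} (hq : 1 < q) (c : Fin 2)
    (h : HasTwoExpansions q (q * x - ((c : ℕ) : ℝ))) : HasTwoExpansions q x := by
  obtain ⟨d, e, hne, hd, he⟩ := h
  refine ⟨_, _, fun heq => hne ?_, hd.cons hq c, he.cons hq c⟩
  ext1 n
  exact congrFun heq (n + 1)

lemma HasTwoExpansions.zero_cons {q x y : ℝ} (hq : 1 < q) (h : HasTwoExpansions q y)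
    (hy : y = q * x) : HasTwoExpansions q x :=
  HasTwoExpansions.cons hq 0 (by simpa [hy] using h)

lemma HasTwoExpansions.one_cons {q x y : ℝ} (hq : 1 < q) (h : HasTwoExpansions q y)
    (hy : y = q * x - 1) : HasTwoExpansions q x :=
  HasTwoExpansions.cons hq 1 (by simpa [hy] using h)

/-- In the switch region `1 ≤ q x ≤ 1 / (q - 1)` both digits can be taken. -/
lemma HasTwoExpansions.of_switch {q x : ℝ} (hq : q ∈ Ioc (1 : ℝ) 2) (h1 : 1 ≤ q * x)
    (h2 : q * (q - 1) * x ≤ 1) : HasTwoExpansions q x := by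
  have hq1 : 0 < q - 1 := by linarith [hq.1]
  have h3 : q * x ≤ 1 / (q - 1) := by rw [le_div_iff₀ hq1]; linarith
  obtain ⟨d, hd⟩ := exists_isExpansion hq (x := q * x) ⟨by linarith, h3⟩
  obtain ⟨e, he⟩ := exists_isExpansion hq (x := q * x - 1) ⟨by linarith, by linarith⟩
  refine ⟨_, _, fun heq => ?_, IsExpansion.cons hq.1 0 (by simpa using hd),
    IsExpansion.cons hq.1 1 (by simpa using he)⟩
  exact absurd (congrFun heq 0) (by simp)

/-! ### Unique expansions -/

/-- A point whose orbit remains in a bounded set `A` disjoint from the switch region has exactly one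
expansion: `q x < 1` forces the digit `0`, and `q x > 1 / (q - 1)` forces the digit `1`. -/
lemma existsUnique_isExpansion_of_forced {q C : ℝ} (hq : q ∈ Ioc (1 : ℝ) 2) {A : Set ℝ}
    (hC : ∀ x ∈ A, |x| ≤ C)
    (hA : ∀ x ∈ A, (q * x < 1 ∧ q * x ∈ A) ∨ (1 < q * (q - 1) * x ∧ q * x - 1 ∈ A))
    {x : ℝ} (hx : x ∈ A) : ∃! d : ℕ → Fin 2, IsExpansion q x d := by
  have hq1 : 0 < q - 1 := by linarith [hq.1]
  have step : ∀ x ∈ A, ∃ c : Fin 2, q * x - ((c : ℕ) : ℝ) ∈ A ∧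
      ∀ e : ℕ → Fin 2, IsExpansion q x e → e 0 = c := by
    intro x hx
    rcases hA x hx with ⟨h1, h2⟩ | ⟨h1, h2⟩
    · refine ⟨0, by simpa using h2, fun e he => ?_⟩
      by_contra hne
      have he0 : e 0 = 1 := by omega
      have := (he.tail hq.1).nonneg hq.1
      rw [he0] at this
      norm_num at this
      linarith
    · refine ⟨1, by simpa using h2, fun e he => ?_⟩
      by_contra hne
      have he0 : e 0 = 0 := by omega
      have := (he.tail hq.1).le hq.1
      rw [he0, le_div_iff₀ hq1] at this
      norm_num at this
      linarith
  choose! c hcA hcu using step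
  let f : ℝ → ℝ := fun t => q * t - ((c t : ℕ) : ℝ)
  have hmem : ∀ n, f^[n] x ∈ A := by
    intro n
    induction n with
    | zero => exact hx
    | succ n ih => rw [Function.iterate_succ_apply']; exact hcA _ ih
  refine ⟨fun n => c (f^[n] x), isExpansion_of_orbit (T := fun n => f^[n] x) hq.1
    (fun n => by rw [Function.iterate_succ_apply']) (fun n => hC _ (hmem n)), fun e he => ?_⟩
  have htail : ∀ n, IsExpansion q (f^[n] x) (fun k => e (k + n)) := by
    intro n
    induction n with
    | zero => exact he
    | succ n ih =>
      have h := ih.tail hq.1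
      rw [hcu _ (hmem n) _ ih] at h
      rw [Function.iterate_succ_apply']
      simpa only [add_right_comm, add_assoc] using h
  ext1 n
  simpa using hcu _ (hmem n) _ (htail n)

lemma two_mem_univoqueBases : (2 : ℝ) ∈ univoqueBases 1 :=
  ⟨by norm_num, existsUnique_isExpansion_of_forced (C := 1) (A := {1}) (by norm_num)
    (by simp) (by rintro x rfl; right; norm_num) rfl⟩

/-- The base in which `1` has the expansion `1101 (0011)^∞`. The equation solved here says that the
remainder after the digits `1101`, which is `y = q⁴ - q³ - q² - 1`, is the value of
`(0011)^∞`, which is `1 / ((q - 1) (q² + 1))`. -/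
lemma exists_mem_univoqueBases : ∃ p ∈ univoqueBases 1, p < 1.788 := by
  obtain ⟨q, ⟨hl, hu⟩, hq⟩ : ∃ q ∈ Ioo (1.787 : ℝ) 1.788,
      (q ^ 4 - q ^ 3 - q ^ 2 - 1) * ((q - 1) * (q ^ 2 + 1)) = 1 := by
    have hc : ContinuousOn
        (fun q : ℝ => (q ^ 4 - q ^ 3 - q ^ 2 - 1) * ((q - 1) * (q ^ 2 + 1)))
        (Icc 1.787 1.788) := by fun_prop
    exact intermediate_value_Ioo (by norm_num) hc (show (1 : ℝ) ∈ Ioo _ _ by norm_num)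
  have hq2 : q ∈ Ioc (1 : ℝ) 2 := ⟨by linarith, by linarith⟩
  refine ⟨q, ⟨hq2, ?_⟩, hu⟩
  obtain ⟨y, hy⟩ : ∃ y, y = q ^ 4 - q ^ 3 - q ^ 2 - 1 := ⟨_, rfl⟩
  rw [← hy] at hq
  have hs1 : 3.193 < q ^ 2 := by nlinarith
  have hs2 : q ^ 2 < 3.197 := by nlinarith
  have hr1 : 1.406 < q * (q - 1) := by nlinarith
  have hr2 : q * (q - 1) < 1.409 := by nlinarith
  have hz1 : 3.299 < (q - 1) * (q ^ 2 + 1) := by nlinarith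
  have hz2 : (q - 1) * (q ^ 2 + 1) < 3.308 := by nlinarith
  have hy1 : 0.302 < y := by
    by_contra! h
    nlinarith
  have hy2 : y < 0.3032 := by
    by_contra! h
    nlinarith
  have hper : q * (q ^ 3 * y - 1) - 1 = y := by linear_combination (q + 1) * hq
  have h5 : q * y < 1 := by nlinarith
  have h6 : q ^ 2 * y < 0.97 := by nlinarith
  have h6' : 0.96 < q ^ 2 * y := by nlinarith
  have h7 : q ^ 3 * y = q * (q ^ 2 * y) := by ring
  have h7' : 1.7155 < q ^ 3 * y := by nlinarith
  have h7'' : q ^ 3 * y < 2 := by nlinarith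
  have h3 : 0.725 < q * (q * (q - 1) - 1) := by nlinarith
  have h3' : q * (q * (q - 1) - 1) < 1 := by nlinarith
  have hqy : 0 < q * y := by nlinarith
  refine existsUnique_isExpansion_of_forced (C := 2) hq2
    (A := {1, q - 1, q * (q - 1) - 1, q * (q * (q - 1) - 1), y, q * y, q ^ 2 * y, q ^ 3 * y - 1})
    ?_ ?_ (by simp)
  · rintro x (rfl | rfl | rfl | rfl | rfl | rfl | rfl | rfl) <;> rw [abs_le] <;>
      constructor <;> linarith
  · rintro x (rfl | rfl | rfl | rfl | rfl | rfl | rfl | rfl)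
    · right; exact ⟨by linarith, by simp⟩
    · right; exact ⟨by nlinarith, by simp⟩
    · left; exact ⟨h3', by simp⟩
    · right
      refine ⟨by nlinarith, ?_⟩
      have : q * (q * (q * (q - 1) - 1)) - 1 = y := by rw [hy]; ring
      simp [this]
    · left; exact ⟨h5, by simp⟩
    · left
      have : q * (q * y) = q ^ 2 * y := by ring
      exact ⟨by linarith, by simp [this]⟩
    · right; exact ⟨by nlinarith, by simp [h7]⟩
    · right; exact ⟨by nlinarith, by simp [hper]⟩

/-! ### A hole in the set of univoque bases -/

/-- The orbit of `1` with digits `1`, `1`, `0`, `1`, `0` meets the switch region after `0`, `1`, `3`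
or `5` steps when `q` lies in the range of the respective case below. -/
lemma univoqueBases_one_subset :
    univoqueBases 1 ⊆ Icc (1.784 : ℝ) 1.7886 ∪ Ici 1.796 := by
  rintro q ⟨hq, huniq⟩
  by_contra hout
  simp only [mem_union, mem_Icc, mem_Ici, not_or, not_and, not_le] at hout
  obtain ⟨hout, hub⟩ := hout
  have hq1 := hq.1
  refine HasTwoExpansions.not_existsUnique ?_ huniq
  rcases le_or_gt (q * (q - 1)) 1 with h0 | h0
  · exact .of_switch hq (by linarith) (by linarith)
  have hq3 : 1.6 < q := by nlinarith
  rcases le_or_gt (q * (q - 1) * (q - 1)) 1 with h1 | h1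
  · exact .one_cons hq1 (.of_switch hq h0.le h1) (by ring)
  -- From here on `q ^ 2 * (q * (q - 1) - 1) - 1 = (q + 1) * (q * (q - 1) * (q - 1) - 1) > 0`,
  -- so that the point after the digits `110` is not below the switch region.
  have h2 : 1 ≤ q ^ 2 * (q * (q - 1) - 1) := by nlinarith
  rcases lt_or_ge q 1.784 with h3 | h3
  · have h4 : q * (q - 1) * (q * (q * (q - 1) - 1)) ≤ 1 := by
      have e1 : q * (q - 1) ≤ 1.398656 := by nlinarith
      have e2 : q * (q * (q - 1) - 1) ≤ 1.784 * 0.398656 :=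
        mul_le_mul h3.le (by linarith) (by linarith) (by norm_num)
      calc _ ≤ 1.398656 * (1.784 * 0.398656 : ℝ) :=
            mul_le_mul e1 e2 (by nlinarith) (by norm_num)
        _ ≤ 1 := by norm_num
    exact .one_cons hq1 (.one_cons hq1 (.zero_cons hq1
      (.of_switch hq (by linarith) h4) rfl) rfl) (by ring)
  · have h4 := hout h3
    have e1 : 1.41046 ≤ q * (q - 1) := by nlinarith
    have e2 : q * (q - 1) ≤ 1.429616 := by nlinarith
    have e3 : 3.19908 ≤ q ^ 2 := by nlinarith
    have e4 : q ^ 2 ≤ 3.225616 := by nlinarith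
    obtain ⟨z, hz⟩ : ∃ z, z = q * (q * (q * (q - 1) - 1)) - 1 := ⟨_, rfl⟩
    have hz' : z = q ^ 2 * (q * (q - 1) - 1) - 1 := by rw [hz]; ring
    have hz1 : 0.3130 ≤ z := by nlinarith
    have hz2 : z ≤ 0.38578 := by nlinarith
    refine .one_cons hq1 (.one_cons hq1 (.zero_cons hq1 (.one_cons hq1 (.zero_cons hq1
      (.of_switch hq (x := q * z) ?_ ?_) rfl) hz) rfl) rfl) (by ring)
    · nlinarith
    · calc q * (q - 1) * (q * z) ≤ 1.429616 * (1.796 * 0.38578) := by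
            refine mul_le_mul e2 (mul_le_mul hub.le hz2 (by linarith) (by norm_num))
              (mul_nonneg (by linarith) (by linarith)) (by norm_num)
        _ ≤ 1 := by norm_num

/-! ### Sums and products of sets with a wide hole -/

lemma not_ordConnected_add {S : Set ℝ} {m a b p t : ℝ} (hS : S ⊆ Icc m a ∪ Ici b)
    (hp : p ∈ S) (hpa : p ≤ a) (ht : t ∈ S) (hbt : b ≤ t) (hma : m ≤ a) (hgap : 2 * a < m + b) :
    ¬ (S + S).OrdConnected := by
  intro h
  obtain ⟨x, hx, hx'⟩ := exists_between hgap
  obtain ⟨u, hu, v, hv, huv⟩ := h.out (add_mem_add hp hp) (add_mem_add ht ht)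
    (show x ∈ Icc _ _ from ⟨by linarith, by linarith⟩)
  simp only at huv
  have hS' : ∀ w ∈ S, m ≤ w ∧ w ≤ a ∨ b ≤ w := fun w hw => hS hw
  rcases hS' u hu with ⟨hu1, hu2⟩ | hu1 <;> rcases hS' v hv with ⟨hv1, hv2⟩ | hv1 <;>
    linarith

lemma not_ordConnected_mul {S : Set ℝ} {m a b p t : ℝ} (hS : S ⊆ Icc m a ∪ Ici b) (hm : 0 < m)
    (hp : p ∈ S) (hpa : p ≤ a) (ht : t ∈ S) (hbt : b ≤ t) (hma : m ≤ a) (hab : a < b)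
    (hgap : a * a < m * b) : ¬ (S * S).OrdConnected := by
  intro h
  obtain ⟨x, hx, hx'⟩ := exists_between hgap
  have hp0 : m ≤ p := by
    rcases hS hp with h1 | h1
    · exact h1.1
    · exact absurd (mem_Ici.1 h1) (by linarith)
  obtain ⟨u, hu, v, hv, huv⟩ := h.out (mul_mem_mul hp hp) (mul_mem_mul ht ht)
    (show x ∈ Icc _ _ from ⟨by nlinarith, by nlinarith⟩)
  simp only at huv
  have hS' : ∀ w ∈ S, m ≤ w ∧ w ≤ a ∨ b ≤ w := fun w hw => hS hw
  rcases hS' u hu with ⟨hu1, hu2⟩ | hu1 <;> rcases hS' v hv with ⟨hv1, hv2⟩ | hv1 <;>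
    nlinarith

/-- `+` and `*` are the pointwise (algebraic) sum and product of sets of reals; a set of reals is an
interval exactly when it is order-connected (degenerate intervals included). -/
theorem proposition5p1 :
    ¬ (univoqueBases 1 + univoqueBases 1).OrdConnected ∧
    ¬ (univoqueBases 1 * univoqueBases 1).OrdConnected ∧
    ¬ (closure (univoqueBases 1) + closure (univoqueBases 1)).OrdConnected ∧
    ¬ (closure (univoqueBases 1) * closure (univoqueBases 1)).OrdConnected := by
  obtain ⟨p, hp, hlt⟩ := exists_mem_univoqueBases
  have hpa : p ≤ 1.7886 := by linarith
  have h2 := two_mem_univoqueBases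
  have hsub := univoqueBases_one_subset
  have hsub' := closure_minimal hsub (isClosed_Icc.union isClosed_Ici)
  have hp' := subset_closure hp
  have h2' := subset_closure h2
  refine ⟨not_ordConnected_add hsub hp hpa h2 ?_ ?_ ?_,
    not_ordConnected_mul hsub ?_ hp hpa h2 ?_ ?_ ?_ ?_,
    not_ordConnected_add hsub' hp' hpa h2' ?_ ?_ ?_,
    not_ordConnected_mul hsub' ?_ hp' hpa h2' ?_ ?_ ?_ ?_⟩ <;> norm_num
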